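/- Let $p,\tilde p:[0,1]\to\mathbb R$ be piecewise continuous (finitely many discontinuities, finite one-sided limits everywhere), positive and bounded away from $0$, and let $\alpha\in(0,\pi]$, $\beta\in[0,\pi)$. Denote by $\lambda_0<\lambda_1<\cdots$ the eigenvalues, all real and simple, of the boundary value problem $$-u''=\lambda\,p(x)\,u\ \text{ on }(0,1),\qquad u(0)\cos\alpha+u'(0)\sin\alpha=0,\qquad u(1)\cos\beta+u'(1)\sin\beta=0,$$ where a solution $u$ is continuously differentiable on $[0,1]$ and satisfies the equation at every point of $(0,1)$ at which the density is continuous; denote by $\tilde\lambda_0<\tilde\lambda_1<\cdots$ the eigenvalues of the same problem with $\tilde p$ in place of $p$. Let $\tilde\varphi_n$ be the solution of $-u''=\tilde\lambda_n\tilde p\,u$ with $u(0)=\sin\alpha$, $u'(0)=-\cos\alpha$ (an eigenfunction for $\tilde\lambda_n$). Put $\check p=\tilde p/p$ and $(y,z)=\int_0^1 y(x)\overline{z(x)}\,dx$. Fix $n>0$ with $\lambda_n\neq0$, and suppose that $$\lambda_n=\tilde\lambda_n\,\frac{(\check p\,\tilde\varphi_n,\tilde\varphi_n)}{(\tilde\varphi_n,\tilde\varphi_n)}$$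 and, in addition, that $$\lambda_n=\tilde\lambda_n\sup_{x\in[0,1]}\check p(x)\qquad\text{or}\qquad\lambda_n=\tilde\lambda_n\inf_{x\in[0,1]}\check p(x).$$ Then $p(x)=\dfrac{\tilde\lambda_n}{\lambda_n}\,\tilde p(x)$ for all but finitely many $x\in[0,1]$, and in fact at every $x\in[0,1]$ at which $p$ and $\tilde p$ are both continuous from the right (with $x<1$) or both continuous from the left (with $x>0$). In particular, the identity holds at every point of $[0,1]$ if $p$ and $\tilde p$ are continuous on $[0,1]$, or if both are right-continuous on $[0,1)$ and left-continuous at $1$. -/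

import Mathlib

open Set Filter Topology

/-- Piecewise continuity on `[0, 1]`: finitely many interior discontinuities, and finite one-sided
limits everywhere. The values at the jump points and at the end points are not restricted. -/
structure IsPiecewiseContinuous (p : ℝ → ℝ) : Prop where
  finite_discontinuities : {x ∈ Ioo (0 : ℝ) 1 | ¬ ContinuousAt p x}.Finite
  right_limit : ∀ x ∈ Ico (0 : ℝ) 1, ∃ l : ℝ, Tendsto p (𝓝[>] x) (𝓝 l)
  left_limit : ∀ x ∈ Ioc (0 : ℝ) 1, ∃ l : ℝ, Tendsto p (𝓝[<] x) (𝓝 l)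

/-- Density functions of a string: piecewise continuous on `[0, 1]`, positive and bounded away
from `0`. -/
structure IsStringDensity (p : ℝ → ℝ) : Prop where
  piecewiseContinuous : IsPiecewiseContinuous p
  bounded_away : ∃ c : ℝ, 0 < c ∧ ∀ x ∈ Icc (0 : ℝ) 1, c ≤ p x

/-- The derivative on the interval `[0, 1]`, one-sided at the end points. -/
noncomputable def stringDeriv (u : ℝ → ℂ) (x : ℝ) : ℂ :=
  derivWithin u (Icc 0 1) x

/-- Solutions of `-u'' = lam p u` on `(0, 1)` for a piecewise continuous `p`: `u` is continuously
differentiable on `[0, 1]`, and `u'' = -lam p u` at every interior point of continuity of `p`. -/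
structure IsStringSolution (p : ℝ → ℝ) (lam : ℂ) (u : ℝ → ℂ) : Prop where
  contDiffOn : ContDiffOn ℝ 1 u (Icc 0 1)
  equation : ∀ x ∈ Ioo (0 : ℝ) 1, ContinuousAt p x →
    HasDerivAt (stringDeriv u) (-(lam * (p x : ℂ) * u x)) x

/-- Eigenfunctions of the boundary value problem `S(p, α, β)`. -/
structure IsStringEigenfunction (p : ℝ → ℝ) (α β : ℝ) (lam : ℂ) (u : ℝ → ℂ) : Prop where
  solution : IsStringSolution p lam u
  nontrivial : ∃ x ∈ Icc (0 : ℝ) 1, u x ≠ 0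
  left_boundary : u 0 * (Real.cos α : ℂ) + stringDeriv u 0 * (Real.sin α : ℂ) = 0
  right_boundary : u 1 * (Real.cos β : ℂ) + stringDeriv u 1 * (Real.sin β : ℂ) = 0

/-- Eigenvalues of `S(p, α, β)`. -/
def IsStringEigenvalue (p : ℝ → ℝ) (α β : ℝ) (lam : ℂ) : Prop :=
  ∃ u : ℝ → ℂ, IsStringEigenfunction p α β lam u

/-- `lam` is the eigenvalue `λₙ(p, α, β)` in the increasing enumeration `λ₀ < λ₁ < …`: it is an
eigenvalue and exactly `n` eigenvalues lie below it. -/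
def IsNthStringEigenvalue (p : ℝ → ℝ) (α β : ℝ) (n : ℕ) (lam : ℝ) : Prop :=
  IsStringEigenvalue p α β (lam : ℂ) ∧
    {μ : ℝ | IsStringEigenvalue p α β (μ : ℂ) ∧ μ < lam}.encard = (n : ℕ∞)

/-- `u` is the solution `φ(·, lam, α, p)` with `φ(0) = sin α` and `φ'(0) = -cos α`. -/
structure IsStringPhi (p : ℝ → ℝ) (α : ℝ) (lam : ℂ) (u : ℝ → ℂ) : Prop where
  solution : IsStringSolution p lam u
  initial_value : u 0 = (Real.sin α : ℂ)
  initial_deriv : stringDeriv u 0 = -(Real.cos α : ℂ)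

/-- The inner product `(y, z) = ∫₀¹ y z̄ dx`. -/
noncomputable def stringInner (y z : ℝ → ℂ) : ℂ :=
  ∫ x in (0 : ℝ)..1, y x * (starRingEnd ℂ) (z x)

/-- Both functions are continuous at `x` from a common side within `[0, 1]`. -/
def ContinuousFromCommonSide (p q : ℝ → ℝ) (x : ℝ) : Prop :=
  (x < 1 ∧ ContinuousWithinAt p (Icc x 1) x ∧ ContinuousWithinAt q (Icc x 1) x) ∨
    (0 < x ∧ ContinuousWithinAt p (Icc 0 x) x ∧ ContinuousWithinAt q (Icc 0 x) x)

/-!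
Let `S` be the supremum or infimum of `pt / p` for which `lam = lamt * S`. The quotient identity
says that the mean of `pt / p` with respect to the weight `|phit|²` equals its extreme value `S`, so
`pt / p = S` almost everywhere off the zeros of `phit`. By unique continuation for the initial value
problem these zeros are simple, hence finite in number, and one-sided continuity upgrades the
resulting almost everywhere identity `p = (lamt / lam) * pt` to the pointwise one.
-/

open MeasureTheory Bornology

theorem isBounded_image_Icc_of_tendsto_nhdsGT_nhdsLT {α E : Type*} [LinearOrder α]
    [TopologicalSpace α] [CompactIccSpace α] [PseudoMetricSpace E] {f : α → E} {a b : α}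
    (hright : ∀ x ∈ Ico a b, ∃ l, Tendsto f (𝓝[>] x) (𝓝 l))
    (hleft : ∀ x ∈ Ioc a b, ∃ l, Tendsto f (𝓝[<] x) (𝓝 l)) :
    IsBounded (f '' Icc a b) := by
  refine isCompact_Icc.induction_on (p := fun s => IsBounded (f '' s)) (by simp)
    (fun s t hst ht => ht.subset (image_mono hst))
    (fun s t hs ht => by simpa only [image_union] using hs.union ht) fun x hx => ?_
  obtain ⟨s, hs, hfs⟩ : ∃ s ∈ 𝓝[Icc a b ∩ Ioi x] x, IsBounded (f '' s) := by
    rcases hx.2.lt_or_eq with hxb | rfl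
    · obtain ⟨l, hl⟩ := hright x ⟨hx.1, hxb⟩
      exact Metric.exists_isBounded_image_of_tendsto
        (hl.mono_left (nhdsWithin_mono x inter_subset_right))
    · have hempty : Icc a x ∩ Ioi x = ∅ := by grind
      exact ⟨∅, by simp [hempty], by simp⟩
  obtain ⟨t, ht, hft⟩ : ∃ t ∈ 𝓝[Icc a b ∩ Iio x] x, IsBounded (f '' t) := by
    rcases hx.1.lt_or_eq with hax | rfl
    · obtain ⟨l, hl⟩ := hleft x ⟨hax, hx.2⟩
      exact Metric.exists_isBounded_image_of_tendsto
        (hl.mono_left (nhdsWithin_mono x inter_subset_right))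
    · have hempty : Icc a b ∩ Iio a = ∅ := by grind
      exact ⟨∅, by simp [hempty], by simp⟩
  have hcover : Icc a b ⊆ Icc a b ∩ Ioi x ∪ (Icc a b ∩ Iio x ∪ {x}) := by grind
  refine ⟨s ∪ (t ∪ {x}), nhdsWithin_mono x hcover ?_, ?_⟩
  · rw [nhdsWithin_union, nhdsWithin_union]
    exact union_mem_sup hs (union_mem_sup ht (by simp))
  · simpa only [image_union, image_singleton] using hfs.union (hft.union isBounded_singleton)

theorem monotoneOn_Icc_of_hasDerivAt_nonneg_off_finite {f f' : ℝ → ℝ} {s : Set ℝ} (hs : s.Finite)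
    {a b : ℝ} (hf : ContinuousOn f (Icc a b)) (hf' : ∀ x ∈ Ioo a b \ s, HasDerivAt f (f' x) x)
    (hnonneg : ∀ x ∈ Ioo a b \ s, 0 ≤ f' x) : MonotoneOn f (Icc a b) := by
  induction s, hs using Set.Finite.induction_on generalizing a b with
  | empty =>
    simp only [sdiff_empty] at hf' hnonneg
    refine monotoneOn_of_deriv_nonneg (convex_Icc a b) hf ?_ ?_ <;> rw [interior_Icc]
    · exact fun x hx => (hf' x hx).differentiableAt.differentiableWithinAt
    · exact fun x hx => (hf' x hx).deriv ▸ hnonneg x hx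
  | @insert c s _ _ ih =>
    have ih' : ∀ a' b', Icc a' b' ⊆ Icc a b → Ioo a' b' \ s ⊆ Ioo a b \ insert c s →
        MonotoneOn f (Icc a' b') := fun a' b' hIcc hIoo =>
      ih (hf.mono hIcc) (fun x hx => hf' x (hIoo hx)) fun x hx => hnonneg x (hIoo hx)
    by_cases hc : c ∈ Ioo a b
    · rw [← Icc_union_Icc_eq_Icc hc.1.le hc.2.le]
      exact (ih' a c (by grind) (by grind)).union_right (ih' c b (by grind) (by grind))
        (isGreatest_Icc hc.1.le) (isLeast_Icc hc.2.le)
    · exact ih' a b Subset.rfl (by grind)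

theorem monotoneOn_exp_mul_of_neg_mul_le_deriv {g g' : ℝ → ℝ} {s : Set ℝ} (hs : s.Finite)
    {a b C : ℝ} (hg : ContinuousOn g (Icc a b)) (hg' : ∀ x ∈ Ioo a b \ s, HasDerivAt g (g' x) x)
    (hle : ∀ x ∈ Ioo a b \ s, -(C * g x) ≤ g' x) :
    MonotoneOn (fun x => Real.exp (C * x) * g x) (Icc a b) := by
  refine monotoneOn_Icc_of_hasDerivAt_nonneg_off_finite hs (by fun_prop)
    (fun x hx => (((hasDerivAt_id x).const_mul C).exp).mul (hg' x hx)) fun x hx => ?_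
  have := mul_nonneg (Real.exp_pos (C * x)).le (neg_le_iff_add_nonneg.1 (hle x hx))
  simp only [id]
  linarith

theorem nonpos_of_abs_deriv_le_mul {g g' : ℝ → ℝ} {s : Set ℝ} (hs : s.Finite) {a b C : ℝ}
    (hg : ContinuousOn g (Icc a b)) (hg' : ∀ x ∈ Ioo a b \ s, HasDerivAt g (g' x) x)
    (hbound : ∀ x ∈ Ioo a b \ s, |g' x| ≤ C * g x) {x₀ y : ℝ} (hx₀ : x₀ ∈ Icc a b)
    (hgx₀ : g x₀ ≤ 0) (hy : y ∈ Icc a b) : g y ≤ 0 := by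
  rcases le_total y x₀ with hle | hle
  · have hmono := monotoneOn_exp_mul_of_neg_mul_le_deriv (C := C) hs hg hg'
      fun x hx => (abs_le.1 (hbound x hx)).1
    have := (hmono hy hx₀ hle).trans (mul_nonpos_of_nonneg_of_nonpos (Real.exp_pos _).le hgx₀)
    exact nonpos_of_mul_nonpos_right this (Real.exp_pos _)
  · have hmono := monotoneOn_exp_mul_of_neg_mul_le_deriv (C := -C) hs hg.neg
      (fun x hx => (hg' x hx).neg) fun x hx => by
        simpa using (abs_le.1 (hbound x hx)).2
    have := (mul_nonneg (Real.exp_pos _).le (neg_nonneg.2 hgx₀)).trans (hmono hx₀ hy hle)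
    exact neg_nonneg.1 (nonneg_of_mul_nonneg_right this (Real.exp_pos _))

theorem finite_zeros_of_hasDerivWithinAt_ne_zero {F : Type*} [NormedAddCommGroup F]
    [NormedSpace ℝ F] {f f' : ℝ → F} {K : Set ℝ} (hK : IsCompact K)
    (hf : ∀ x ∈ K, HasDerivWithinAt f (f' x) K x) (hsimple : ∀ x ∈ K, f x = 0 → f' x ≠ 0) :
    {x ∈ K | f x = 0}.Finite := by
  by_contra hinf
  obtain ⟨x, hx, hacc⟩ := Set.Infinite.exists_accPt_of_subset_isCompact hinf hK (sep_subset _ _)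
  have hfreq : ∃ᶠ y in 𝓝[K \ {x}] x, f y = 0 := by
    rw [accPt_iff_frequently] at hacc
    rw [frequently_nhdsWithin_iff]
    exact hacc.mono fun y hy => ⟨hy.2.2, hy.2.1, hy.1⟩
  have hfx : f x = 0 := tendsto_nhds_unique_of_frequently_eq
    ((hf x hx).continuousWithinAt.mono sdiff_subset) tendsto_const_nhds hfreq
  exact hfreq ((hf x hx).eventually_ne (hsimple x hx hfx))

theorem ae_eq_of_const_le_of_integral_mul_eq {X : Type*} [MeasurableSpace X] {μ : Measure X}
    {f w : X → ℝ} {S : ℝ} (hw : Integrable w μ) (hfw : Integrable (fun x => f x * w x) μ)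
    (hpos : ∀ᵐ x ∂μ, 0 < w x) (hS : ∀ᵐ x ∂μ, S ≤ f x)
    (hmean : ∫ x, f x * w x ∂μ = S * ∫ x, w x ∂μ) : ∀ᵐ x ∂μ, f x = S := by
  have hnonneg : 0 ≤ᵐ[μ] fun x => f x * w x - S * w x := by
    filter_upwards [hpos, hS] with x hwx hSx
    exact sub_nonneg.2 (mul_le_mul_of_nonneg_right hSx hwx.le)
  have hzero : ∫ x, (f x * w x - S * w x) ∂μ = 0 := by
    rw [integral_sub hfw (hw.const_mul S), integral_const_mul, hmean, sub_self]
  rw [integral_eq_zero_iff_of_nonneg_ae hnonneg (hfw.sub (hw.const_mul S))] at hzero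
  filter_upwards [hzero, hpos] with x hx hwx
  exact mul_right_cancel₀ hwx.ne' (sub_eq_zero.1 hx)

theorem ae_eq_of_le_const_of_integral_mul_eq {X : Type*} [MeasurableSpace X] {μ : Measure X}
    {f w : X → ℝ} {S : ℝ} (hw : Integrable w μ) (hfw : Integrable (fun x => f x * w x) μ)
    (hpos : ∀ᵐ x ∂μ, 0 < w x) (hS : ∀ᵐ x ∂μ, f x ≤ S)
    (hmean : ∫ x, f x * w x ∂μ = S * ∫ x, w x ∂μ) : ∀ᵐ x ∂μ, f x = S := by
  have hneg := ae_eq_of_const_le_of_integral_mul_eq (f := fun x => -f x) (S := -S) hw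
    (by simpa only [neg_mul] using! hfw.neg) hpos (hS.mono fun x hx => neg_le_neg hx)
    (by simp only [neg_mul, integral_neg, hmean])
  exact hneg.mono fun x hx => neg_inj.1 hx

theorem integrableOn_mul_norm_sq {E : Type*} [NormedAddCommGroup E] {f : ℝ → ℝ} {u : ℝ → E}
    {a b : ℝ} (hf : AEStronglyMeasurable f (volume.restrict (Ioc a b)))
    (hbdd : IsBounded (f '' Icc a b)) (hu : ContinuousOn u (Icc a b)) :
    IntegrableOn (fun x => f x * ‖u x‖ ^ 2) (Ioc a b) := by
  obtain ⟨C, hC⟩ := isBounded_iff_forall_norm_le.1 hbdd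
  refine Integrable.bdd_mul (c := C) ?_ hf ?_
  · exact (hu.norm.pow 2).integrableOn_Icc.mono_set Ioc_subset_Icc_self
  · filter_upwards [ae_restrict_mem measurableSet_Ioc] with x hx
    exact hC _ (mem_image_of_mem f (Ioc_subset_Icc_self hx))

/-- The discontinuities of a density in the open interval `(0, 1)`, the set that
`IsPiecewiseContinuous` requires to be finite. -/
def interiorDiscontinuities (p : ℝ → ℝ) : Set ℝ :=
  {x ∈ Ioo (0 : ℝ) 1 | ¬ ContinuousAt p x}

theorem continuousAt_of_mem_Ioo_diff {p : ℝ → ℝ} {x : ℝ}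
    (hx : x ∈ Ioo (0 : ℝ) 1 \ interiorDiscontinuities p) : ContinuousAt p x :=
  by_contra fun hc => hx.2 ⟨hx.1, hc⟩

theorem aestronglyMeasurable_of_countable_interiorDiscontinuities {p : ℝ → ℝ}
    (hp : (interiorDiscontinuities p).Countable) :
    AEStronglyMeasurable p (volume.restrict (Ioc (0 : ℝ) 1)) := by
  have hcont : ContinuousOn p (Ioo (0 : ℝ) 1 \ interiorDiscontinuities p) := fun x hx =>
    (continuousAt_of_mem_Ioo_diff hx).continuousWithinAt
  have hae : (Ioo (0 : ℝ) 1 \ interiorDiscontinuities p : Set ℝ) =ᵐ[volume] Ioc (0 : ℝ) 1 :=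
    (sdiff_null_ae_eq_self (hp.measure_zero volume)).trans Ioo_ae_eq_Ioc
  rw [← Measure.restrict_congr_set hae]
  exact hcont.aestronglyMeasurable (measurableSet_Ioo.diff hp.measurableSet)

theorem finite_ne_of_ae_eq {p q : ℝ → ℝ} (hp : (interiorDiscontinuities p).Finite)
    (hq : (interiorDiscontinuities q).Finite) (hae : p =ᵐ[volume.restrict (Ioc (0 : ℝ) 1)] q) :
    {x ∈ Icc (0 : ℝ) 1 | p x ≠ q x}.Finite := by
  set D := interiorDiscontinuities p ∪ interiorDiscontinuities q
  have heq : EqOn p q (Ioo (0 : ℝ) 1 \ D) := by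
    refine Measure.eqOn_open_of_ae_eq (μ := volume) ?_
      (isOpen_Ioo.sdiff (hp.union hq).isClosed) ?_ ?_
    · exact ae_restrict_of_ae_restrict_of_subset (sdiff_subset.trans Ioo_subset_Ioc_self) hae
    · exact fun x hx => (continuousAt_of_mem_Ioo_diff
        ⟨hx.1, fun h => hx.2 (.inl h)⟩).continuousWithinAt
    · exact fun x hx => (continuousAt_of_mem_Ioo_diff
        ⟨hx.1, fun h => hx.2 (.inr h)⟩).continuousWithinAt
  refine ((hp.union hq).union (Set.toFinite {(0 : ℝ), 1})).subset fun x ⟨hx, hne⟩ => ?_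
  by_contra hcon
  exact hne (heq (by grind))

theorem interiorDiscontinuities_const_mul_subset (c : ℝ) (p : ℝ → ℝ) :
    interiorDiscontinuities (fun x => c * p x) ⊆ interiorDiscontinuities p :=
  fun _ hx => ⟨hx.1, fun hc => hx.2 (hc.const_mul c)⟩

theorem IsPiecewiseContinuous.isBounded_image {p : ℝ → ℝ} (hp : IsPiecewiseContinuous p) :
    IsBounded (p '' Icc 0 1) :=
  isBounded_image_Icc_of_tendsto_nhdsGT_nhdsLT hp.right_limit hp.left_limit

theorem isBounded_image_div {α : Type*} {p q : α → ℝ} {s : Set α} {c : ℝ} (hc : 0 < c)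
    (hp : ∀ x ∈ s, c ≤ |p x|) (hq : IsBounded (q '' s)) :
    IsBounded ((fun x => q x / p x) '' s) := by
  obtain ⟨M, hM⟩ := isBounded_iff_forall_norm_le.1 hq
  refine isBounded_iff_forall_norm_le.2 ⟨M / c, forall_mem_image.2 fun x hx => ?_⟩
  have hqx : ‖q x‖ ≤ M := hM _ (mem_image_of_mem q hx)
  rw [norm_div]
  exact div_le_div₀ ((norm_nonneg _).trans hqx) hqx hc (hp x hx)

theorem ContinuousFromCommonSide.const_mul_right {p q : ℝ → ℝ} {x : ℝ}
    (h : ContinuousFromCommonSide p q x) (c : ℝ) :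
    ContinuousFromCommonSide p (fun y => c * q y) x :=
  h.imp (fun ⟨hx, hp, hq⟩ => ⟨hx, hp, hq.const_mul c⟩) fun ⟨hx, hp, hq⟩ => ⟨hx, hp, hq.const_mul c⟩

theorem ContinuousFromCommonSide.eq_of_finite_ne {p q : ℝ → ℝ} {x : ℝ} (hx : x ∈ Icc (0 : ℝ) 1)
    (h : ContinuousFromCommonSide p q x) (hfin : {x ∈ Icc (0 : ℝ) 1 | p x ≠ q x}.Finite) :
    p x = q x := by
  have hev : ∀ᶠ y in 𝓝[≠] x, y ∈ Icc (0 : ℝ) 1 → p y = q y := by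
    filter_upwards [nhdsNE_le_cofinite x hfin.compl_mem_cofinite] with y hy hyI
    exact by_contra fun hne => hy ⟨hyI, hne⟩
  rcases h with ⟨hx1, hp, hq⟩ | ⟨hx0, hp, hq⟩
  · have hle : 𝓝[>] x ≤ 𝓝[Icc x 1] x := nhdsWithin_le_iff.2 (Icc_mem_nhdsGT hx1)
    refine tendsto_nhds_unique_of_eventuallyEq (hp.mono_left hle) (hq.mono_left hle) ?_
    filter_upwards [hev.filter_mono (nhdsGT_le_nhdsNE x), Icc_mem_nhdsGT hx1] with y hy hyI
    exact hy ⟨hx.1.trans hyI.1, hyI.2⟩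
  · have hle : 𝓝[<] x ≤ 𝓝[Icc 0 x] x := nhdsWithin_le_iff.2 (Icc_mem_nhdsLT hx0)
    refine tendsto_nhds_unique_of_eventuallyEq (hp.mono_left hle) (hq.mono_left hle) ?_
    filter_upwards [hev.filter_mono (nhdsLT_le_nhdsNE x), Icc_mem_nhdsLT hx0] with y hy hyI
    exact hy ⟨hyI.1, hyI.2.trans hx.2⟩

theorem stringInner_ofReal_mul_self (f : ℝ → ℝ) (u : ℝ → ℂ) :
    stringInner (fun x => (f x : ℂ) * u x) u =
      ((∫ x in Ioc (0 : ℝ) 1, f x * ‖u x‖ ^ 2 : ℝ) : ℂ) := by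
  rw [stringInner, intervalIntegral.integral_of_le zero_le_one, ← integral_complex_ofReal]
  simp only [mul_assoc, Complex.mul_conj', Complex.ofReal_mul, Complex.ofReal_pow]

theorem stringInner_self (u : ℝ → ℂ) :
    stringInner u u = ((∫ x in Ioc (0 : ℝ) 1, ‖u x‖ ^ 2 : ℝ) : ℂ) := by
  simpa using stringInner_ofReal_mul_self (fun _ => 1) u

theorem stringInner_self_ne_zero {u : ℝ → ℂ} (hu : ContinuousOn u (Icc 0 1))
    (hne : ∃ x ∈ Icc (0 : ℝ) 1, u x ≠ 0) : stringInner u u ≠ 0 := by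
  obtain ⟨x, hx, hux⟩ := hne
  have hpos : 0 < ∫ x in (0 : ℝ)..1, ‖u x‖ ^ 2 :=
    intervalIntegral.integral_pos one_pos (hu.norm.pow 2) (fun _ _ => by positivity)
      ⟨x, hx, by positivity⟩
  rw [stringInner_self, ← intervalIntegral.integral_of_le zero_le_one]
  exact_mod_cast hpos.ne'

theorem abs_two_mul_inner_add_two_mul_inner_le {v w k : ℂ} {N : ℝ} (hk : ‖k‖ ≤ N) :
    |2 * inner ℝ v w + 2 * inner ℝ w (-(k * v))| ≤ (1 + N) * (‖v‖ ^ 2 + ‖w‖ ^ 2) := by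
  have hN : 0 ≤ N := (norm_nonneg k).trans hk
  have hvw : |inner ℝ v w| ≤ ‖v‖ * ‖w‖ := abs_real_inner_le_norm v w
  have hwkv : |inner ℝ w (-(k * v))| ≤ N * (‖v‖ * ‖w‖) :=
    calc |inner ℝ w (-(k * v))| ≤ ‖w‖ * ‖-(k * v)‖ := abs_real_inner_le_norm _ _
      _ = ‖k‖ * (‖v‖ * ‖w‖) := by rw [norm_neg, norm_mul]; ring
      _ ≤ N * (‖v‖ * ‖w‖) := by gcongr
  calc |2 * inner ℝ v w + 2 * inner ℝ w (-(k * v))|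
      ≤ |2 * inner ℝ v w| + |2 * inner ℝ w (-(k * v))| := abs_add_le _ _
    _ = 2 * |inner ℝ v w| + 2 * |inner ℝ w (-(k * v))| := by simp only [abs_mul, abs_two]
    _ ≤ (1 + N) * (2 * ‖v‖ * ‖w‖) := by linarith
    _ ≤ (1 + N) * (‖v‖ ^ 2 + ‖w‖ ^ 2) := by gcongr; exact two_mul_le_add_sq _ _

/-- The squared norm `|u|² + |u'|²` of the Cauchy data of `u`, the quantity to which the Gronwall
argument for unique continuation is applied. -/
noncomputable def stringEnergy (u : ℝ → ℂ) (x : ℝ) : ℝ :=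
  ‖u x‖ ^ 2 + ‖stringDeriv u x‖ ^ 2

namespace IsStringSolution

variable {p : ℝ → ℝ} {lam : ℂ} {u : ℝ → ℂ}

theorem continuousOn_stringDeriv (hu : IsStringSolution p lam u) :
    ContinuousOn (stringDeriv u) (Icc 0 1) :=
  hu.contDiffOn.continuousOn_derivWithin (uniqueDiffOn_Icc one_pos) le_rfl

theorem hasDerivWithinAt (hu : IsStringSolution p lam u) {x : ℝ} (hx : x ∈ Icc (0 : ℝ) 1) :
    HasDerivWithinAt u (stringDeriv u x) (Icc 0 1) x :=
  (hu.contDiffOn.differentiableOn one_ne_zero x hx).hasDerivWithinAt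

theorem continuousOn_stringEnergy (hu : IsStringSolution p lam u) :
    ContinuousOn (stringEnergy u) (Icc 0 1) :=
  (hu.contDiffOn.continuousOn.norm.pow 2).add (hu.continuousOn_stringDeriv.norm.pow 2)

theorem hasDerivAt_stringEnergy (hu : IsStringSolution p lam u) {x : ℝ}
    (hx : x ∈ Ioo (0 : ℝ) 1 \ interiorDiscontinuities p) :
    HasDerivAt (stringEnergy u) (2 * inner ℝ (u x) (stringDeriv u x) +
      2 * inner ℝ (stringDeriv u x) (-(lam * (p x : ℂ) * u x))) x :=
  ((hu.hasDerivWithinAt (Ioo_subset_Icc_self hx.1)).hasDerivAt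
    (Icc_mem_nhds hx.1.1 hx.1.2)).norm_sq.add
    (hu.equation x hx.1 (continuousAt_of_mem_Ioo_diff hx)).norm_sq

theorem eqOn_zero (hp : IsPiecewiseContinuous p) (hu : IsStringSolution p lam u) {x₀ : ℝ}
    (hx₀ : x₀ ∈ Icc (0 : ℝ) 1) (hux₀ : u x₀ = 0) (hu'x₀ : stringDeriv u x₀ = 0) :
    EqOn u 0 (Icc 0 1) := by
  obtain ⟨M, hM⟩ := isBounded_iff_forall_norm_le.1 hp.isBounded_image
  intro y hy
  have henergy : stringEnergy u y ≤ 0 := by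
    refine nonpos_of_abs_deriv_le_mul (C := 1 + ‖lam‖ * M) hp.finite_discontinuities
      hu.continuousOn_stringEnergy (fun x hx => hu.hasDerivAt_stringEnergy hx) (fun x hx => ?_)
      hx₀ (by simp [stringEnergy, hux₀, hu'x₀]) hy
    refine abs_two_mul_inner_add_two_mul_inner_le ?_
    rw [norm_mul, Complex.norm_real]
    gcongr
    exact hM _ (mem_image_of_mem p (Ioo_subset_Icc_self hx.1))
  have hnorm : ‖u y‖ ^ 2 ≤ 0 := (le_add_of_nonneg_right (sq_nonneg _)).trans henergy
  simpa using hnorm.antisymm (sq_nonneg _)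

theorem finite_zeros (hp : IsPiecewiseContinuous p) (hu : IsStringSolution p lam u)
    (hne : ∃ x ∈ Icc (0 : ℝ) 1, u x ≠ 0) : {x ∈ Icc (0 : ℝ) 1 | u x = 0}.Finite := by
  obtain ⟨y, hy, huy⟩ := hne
  exact finite_zeros_of_hasDerivWithinAt_ne_zero isCompact_Icc (fun x hx => hu.hasDerivWithinAt hx)
    fun x hx hux hu'x => huy (hu.eqOn_zero hp hx hux hu'x hy)

theorem ae_norm_sq_pos (hp : IsPiecewiseContinuous p) (hu : IsStringSolution p lam u)
    (hne : ∃ x ∈ Icc (0 : ℝ) 1, u x ≠ 0) :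
    ∀ᵐ x ∂volume.restrict (Ioc (0 : ℝ) 1), 0 < ‖u x‖ ^ 2 := by
  filter_upwards [ae_restrict_mem measurableSet_Ioc,
    ae_restrict_of_ae ((hu.finite_zeros hp hne).countable.ae_notMem volume)] with x hx hux
  have : u x ≠ 0 := fun h => hux ⟨Ioc_subset_Icc_self hx, h⟩
  positivity

theorem ae_eq_of_stringInner_eq_mul (hp : IsPiecewiseContinuous p) (hu : IsStringSolution p lam u)
    (hne : ∃ x ∈ Icc (0 : ℝ) 1, u x ≠ 0) {f : ℝ → ℝ} {S : ℝ}
    (hf : AEStronglyMeasurable f (volume.restrict (Ioc 0 1))) (hbdd : IsBounded (f '' Icc 0 1))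
    (hS : (∀ x ∈ Icc (0 : ℝ) 1, S ≤ f x) ∨ ∀ x ∈ Icc (0 : ℝ) 1, f x ≤ S)
    (hmean : stringInner (fun x => (f x : ℂ) * u x) u = (S : ℂ) * stringInner u u) :
    ∀ᵐ x ∂volume.restrict (Ioc (0 : ℝ) 1), f x = S := by
  have hcont := hu.contDiffOn.continuousOn
  have hw : IntegrableOn (fun x => ‖u x‖ ^ 2) (Ioc 0 1) :=
    (hcont.norm.pow 2).integrableOn_Icc.mono_set Ioc_subset_Icc_self
  have hfw := integrableOn_mul_norm_sq hf hbdd hcont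
  have hpos := hu.ae_norm_sq_pos hp hne
  rw [stringInner_ofReal_mul_self, stringInner_self] at hmean
  norm_cast at hmean
  rcases hS with hS | hS
  · refine ae_eq_of_const_le_of_integral_mul_eq hw hfw hpos ?_ hmean
    exact ae_restrict_of_forall_mem measurableSet_Ioc fun x hx => hS x (Ioc_subset_Icc_self hx)
  · refine ae_eq_of_le_const_of_integral_mul_eq hw hfw hpos ?_ hmean
    exact ae_restrict_of_forall_mem measurableSet_Ioc fun x hx => hS x (Ioc_subset_Icc_self hx)

end IsStringSolution

theorem IsStringPhi.exists_ne_zero {p : ℝ → ℝ} {α : ℝ} {lam : ℂ} {u : ℝ → ℂ}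
    (hu : IsStringPhi p α lam u) : ∃ x ∈ Icc (0 : ℝ) 1, u x ≠ 0 := by
  by_contra! hzero
  have hsin : Real.sin α = 0 := by
    exact_mod_cast hu.initial_value.symm.trans (hzero 0 (by simp))
  have hderiv : stringDeriv u 0 = 0 := by
    rw [stringDeriv, derivWithin_congr hzero (hzero 0 (by simp)), derivWithin_fun_const]
    rfl
  have hcos : Real.cos α = 0 := by
    exact_mod_cast neg_eq_zero.1 (hu.initial_deriv.symm.trans hderiv)
  simpa [hsin, hcos] using Real.sin_sq_add_cos_sq α

theorem theorem2p3_general {p pt : ℝ → ℝ} (hp : (interiorDiscontinuities p).Finite)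
    (hpt : IsPiecewiseContinuous pt) {c : ℝ} (hc : 0 < c)
    (hcp : ∀ x ∈ Icc (0 : ℝ) 1, c ≤ |p x|) {lam lamt : ℝ} (hlam0 : lam ≠ 0) {u : ℝ → ℂ}
    (hu : IsStringSolution pt lamt u) (hne : ∃ x ∈ Icc (0 : ℝ) 1, u x ≠ 0)
    (hquot : (lam : ℂ) = (lamt : ℂ) *
      (stringInner (fun x => ((pt x / p x : ℝ) : ℂ) * u x) u / stringInner u u))
    (hext : lam = lamt * sSup ((fun x => pt x / p x) '' Icc (0 : ℝ) 1) ∨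
      lam = lamt * sInf ((fun x => pt x / p x) '' Icc (0 : ℝ) 1)) :
    {x ∈ Icc (0 : ℝ) 1 | p x ≠ lamt / lam * pt x}.Finite ∧
      ∀ x ∈ Icc (0 : ℝ) 1, ContinuousFromCommonSide p pt x → p x = lamt / lam * pt x := by
  have hbdd := isBounded_image_div hc hcp hpt.isBounded_image
  obtain ⟨S, hlam, hS⟩ : ∃ S, lam = lamt * S ∧
      ((∀ x ∈ Icc (0 : ℝ) 1, S ≤ pt x / p x) ∨ ∀ x ∈ Icc (0 : ℝ) 1, pt x / p x ≤ S) := by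
    rcases hext with hsup | hinf
    · exact ⟨_, hsup, .inr fun x hx => le_csSup hbdd.bddAbove (mem_image_of_mem _ hx)⟩
    · exact ⟨_, hinf, .inl fun x hx => csInf_le hbdd.bddBelow (mem_image_of_mem _ hx)⟩
  have hlamt0 : lamt ≠ 0 := left_ne_zero_of_mul (hlam ▸ hlam0)
  have hmean : stringInner (fun x => ((pt x / p x : ℝ) : ℂ) * u x) u =
      (S : ℂ) * stringInner u u := by
    rw [← div_eq_iff (stringInner_self_ne_zero hu.contDiffOn.continuousOn hne)]
    refine mul_left_cancel₀ (Complex.ofReal_ne_zero.2 hlamt0) ?_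
    rw [← hquot, hlam, Complex.ofReal_mul]
  have hmeas : AEStronglyMeasurable (fun x => pt x / p x) (volume.restrict (Ioc 0 1)) :=
    (aestronglyMeasurable_of_countable_interiorDiscontinuities
      hpt.finite_discontinuities.countable).div₀
      (aestronglyMeasurable_of_countable_interiorDiscontinuities hp.countable)
  have hae : p =ᵐ[volume.restrict (Ioc 0 1)] fun x => lamt / lam * pt x := by
    filter_upwards [hu.ae_eq_of_stringInner_eq_mul hpt hne hmeas hbdd hS hmean,
      ae_restrict_mem measurableSet_Ioc] with x hx hxI
    have hpx : p x ≠ 0 := abs_pos.1 (hc.trans_le (hcp x (Ioc_subset_Icc_self hxI)))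
    rw [div_mul_eq_mul_div, eq_div_iff hlam0, hlam, (div_eq_iff hpx).1 hx]
    ring
  have hfin := finite_ne_of_ae_eq hp (hpt.finite_discontinuities.subset
    (interiorDiscontinuities_const_mul_subset _ _)) hae
  exact ⟨hfin, fun x hx hside => (hside.const_mul_right _).eq_of_finite_ne hx hfin⟩


theorem theorem2p3 (p pt : ℝ → ℝ) (hp : IsStringDensity p) (hpt : IsStringDensity pt)
    (α β : ℝ) (hα : α ∈ Set.Ioc 0 Real.pi) (hβ : β ∈ Set.Ico 0 Real.pi)
    (n : ℕ) (hn : 0 < n) (lam lamt : ℝ)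
    (hlam : IsNthStringEigenvalue p α β n lam)
    (hlamt : IsNthStringEigenvalue pt α β n lamt)
    (hlam0 : lam ≠ 0)
    (phit : ℝ → ℂ) (hphit : IsStringPhi pt α (lamt : ℂ) phit)
    (hquot : (lam : ℂ) = (lamt : ℂ) *
      (stringInner (fun x => ((pt x / p x : ℝ) : ℂ) * phit x) phit / stringInner phit phit))
    (hext : lam = lamt * sSup ((fun x => pt x / p x) '' Set.Icc (0 : ℝ) 1) ∨
      lam = lamt * sInf ((fun x => pt x / p x) '' Set.Icc (0 : ℝ) 1)) :
    {x ∈ Set.Icc (0 : ℝ) 1 | p x ≠ lamt / lam * pt x}.Finite ∧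
      ∀ x ∈ Set.Icc (0 : ℝ) 1, ContinuousFromCommonSide p pt x →
        p x = lamt / lam * pt x := by
  obtain ⟨c, hc, hcp⟩ := hp.bounded_away
  exact theorem2p3_general hp.piecewiseContinuous.finite_discontinuities hpt.piecewiseContinuous hc
    (fun x hx => (hcp x hx).trans (le_abs_self _)) hlam0 hphit.solution hphit.exists_ne_zero
    hquot hext
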